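/- Let $M$ be a complex manifold (of finite dimension) and let $L=T^{1,0}\oplus T^{*(0,1)}\subset (T\oplus T^*)_{\mathbb C}$, $\overline L=T^{0,1}\oplus T^{*(1,0)}$. The sections of $L$ and those of $\overline L$ are closed under the Courant bracket $$[\![X+\alpha,Y+\beta]\!]=[X,Y]+\mathcal L_X\beta-\mathcal L_Y\alpha-\tfrac12 d(\iota_X\beta-\iota_Y\alpha).$$ Denote by $[\![-,-]\!]$ also the Schouten bracket on $C^\infty(M,\wedge^\bullet L)$, i.e. the extension of the bracket of $L$ as a graded biderivation of the exterior product with $[\![X+\alpha,f]\!]=Xf$ and $[\![f,g]\!]=0$ for functions $f,g$. Let $\overline\partial:C^\infty(M,\wedge^kL)\to C^\infty(M,\wedge^{k+1}L)$ be the Lie algebroid differential of $\overline L$, where $\overline L$ is identified with $L^*$ through the pairing $(X+\alpha,Y+\beta)\mapsto\alpha(Y)+\beta(X)$. A section $\phi$ of $L^*\otimes L=\mathrm{End}(L)$ acts on $\wedge^\bullet L$ as the derivation of degree $0$ that extends it and vanishes on functions. A pair of smooth sections $\Gamma_1\in C^\infty(M,\wedge^2L)$ and $\phi\in C^\infty(M,L^*\otimes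 L)$ is called compatible if $\overline\partial\Gamma_1=0$ and, for all $A,B\in C^\infty(M,\wedge^\bullet L)$, $$\overline\partial(\phi A)-\phi(\overline\partial A)=[\![\Gamma_1,A]\!],\qquad [\![\phi A,B]\!]+[\![A,\phi B]\!]=\phi[\![A,B]\!],\qquad \phi(A\wedge B)=(\phi A)\wedge B+A\wedge(\phi B).$$ Proposition. Let $\Gamma_1\in C^\infty(M,\wedge^2L)$ and $\phi\in C^\infty(M,L^*\otimes L)$. Write $\Gamma_1=\Lambda+\widehat\Gamma_1+\Omega$ with $\Lambda$, $\widehat\Gamma_1$, $\Omega$ the components of $\Gamma_1$ in $\wedge^2T^{1,0}$, $T^{1,0}\otimes T^{*(0,1)}$, $\wedge^2T^{*(0,1)}$, and write $\phi=\phi_1+\phi_2+\phi_3+\phi_4$ with $\phi_1,\phi_2,\phi_3,\phi_4$ the blocks of $\phi$ in $\mathrm{End}(T^{1,0},T^{1,0})$, $\mathrm{End}(T^{*(0,1)},T^{*(0,1)})$, $\mathrm{End}(T^{1,0},T^{*(0,1)})$, $\mathrm{End}(T^{*(0,1)},T^{1,0})$, where $\mathrm{End}(V,W)$ denotes the bundle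 maps from $V$ to $W$. Then the pair $(\Gamma_1,\phi)$ is compatible if and only if the three pairs $(\Lambda,\phi_4)$, $(\Omega,\phi_3)$ and $(\widehat\Gamma_1,\phi_1+\phi_2)$ are all compatible. -/

import Mathlib

open scoped Manifold ContDiff

noncomputable section

namespace ComplexDGA

section Fibre

variable (E : Type*) [NormedAddCommGroup E] [NormedSpace ℂ E]

/-- The fibre of the bundle `L = T^{1,0} ⊕ T^{*(0,1)}` of a complex manifold modelled on `E`.
Mathlib identifies the tangent space at a point `x` with `E` through the preferred chart at `x`, and
the complex structure is multiplication by `Complex.I` on `E`. A vector `v : E` stands for the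
`(1,0)`-vector `(v - i J v) / 2`. A `(0,1)`-covector is a complex valued covector that is
conjugate-linear for the complex structure. -/
abbrev LFibre : Type _ := E × (E →L⋆[ℂ] ℂ)

/-- The exterior algebra `∧^• L_x` of the fibre. -/
abbrev ExtL : Type _ := ExteriorAlgebra ℂ (LFibre E)

variable {E}

/-- The projection of `L` onto `T^{1,0}` along `T^{*(0,1)}`. -/
def projT : LFibre E →L[ℂ] LFibre E :=
  (ContinuousLinearMap.inl ℂ E (E →L⋆[ℂ] ℂ)).comp (ContinuousLinearMap.fst ℂ E (E →L⋆[ℂ] ℂ))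

/-- The projection of `L` onto `T^{*(0,1)}` along `T^{1,0}`. -/
def projTstar : LFibre E →L[ℂ] LFibre E :=
  (ContinuousLinearMap.inr ℂ E (E →L⋆[ℂ] ℂ)).comp (ContinuousLinearMap.snd ℂ E (E →L⋆[ℂ] ℂ))

variable [FiniteDimensional ℂ E]

instance finiteDimensional_conjDual : FiniteDimensional ℂ (E →L⋆[ℂ] ℂ) := by
  let b := Module.finBasis ℂ E
  let f : (E →L⋆[ℂ] ℂ) →ₗ[ℂ] (Fin (Module.finrank ℂ E) → ℂ) :=
    { toFun := fun β i => β (b i)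
      map_add' := fun _ _ => rfl
      map_smul' := fun _ _ => rfl }
  refine FiniteDimensional.of_injective f fun β γ h => ?_
  apply ContinuousLinearMap.coe_injective
  exact b.ext fun i => congrFun h i

instance finite_extL : Module.Finite ℂ (ExtL E) := by
  have htop : (⨆ i, (⋀[ℂ]^i (LFibre E) : Submodule ℂ (ExtL E))) = ⊤ :=
    (DirectSum.Decomposition.isInternal
      (fun i : ℕ => ⋀[ℂ]^i (LFibre E))).submodule_iSup_eq_top
  have hz : ∀ i, Module.finrank ℂ (LFibre E) < i →
      (⋀[ℂ]^i (LFibre E) : Submodule ℂ (ExtL E)) = ⊥ := by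
    intro i hi
    rw [← Submodule.finrank_eq_zero (R := ℂ), exteriorPower.finrank_eq,
      Nat.choose_eq_zero_of_lt hi]
  have hfin : (⨆ i : Fin (Module.finrank ℂ (LFibre E) + 1),
      (⋀[ℂ]^(i : ℕ) (LFibre E) : Submodule ℂ (ExtL E))) = ⊤ := by
    rw [eq_top_iff, ← htop]
    refine iSup_le fun i => ?_
    by_cases hi : Module.finrank ℂ (LFibre E) < i
    · rw [hz i hi]
      exact bot_le
    · exact le_iSup_of_le (⟨i, by omega⟩ : Fin (Module.finrank ℂ (LFibre E) + 1)) le_rfl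
  rw [Module.finite_def, ← hfin]
  exact Submodule.fg_iSup _ (fun i => Module.Finite.iff_fg.mp inferInstance)

/-- A norm on the finite-dimensional space `∧^• L_x`: the supremum norm of the coordinates in a
basis. It serves only to speak of derivatives of maps into `∧^• L_x`, for which the choice of the
norm is immaterial. -/
instance normedAddCommGroup_extL : NormedAddCommGroup (ExtL E) :=
  NormedAddCommGroup.induced (ExtL E) (Fin (Module.finrank ℂ (ExtL E)) → ℂ)
    (Module.finBasis ℂ (ExtL E)).equivFun (Module.finBasis ℂ (ExtL E)).equivFun.injective

instance normedSpace_extL : NormedSpace ℂ (ExtL E) :=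
  NormedSpace.induced ℂ (ExtL E) (Fin (Module.finrank ℂ (ExtL E)) → ℂ)
    (Module.finBasis ℂ (ExtL E)).equivFun

/-- The extension of an endomorphism `φ` of `L_x` to `∧^• L_x` as a derivation of degree `0`:
`φ(a₁ ∧ … ∧ aₖ) = ∑ᵢ a₁ ∧ … ∧ φ aᵢ ∧ … ∧ aₖ`. If `φ = ∑ₖ eᵏ ⊗ φ eₖ` as an element of `L* ⊗ L`, it is
`A ↦ ∑ₖ (φ eₖ) ∧ (eᵏ ⌋ A)`; it vanishes on scalars. -/
def derivExt (φ : LFibre E →L[ℂ] LFibre E) : ExtL E →ₗ[ℂ] ExtL E :=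
  ∑ k, LinearMap.mulLeft ℂ (ExteriorAlgebra.ι ℂ (φ (Module.finBasis ℂ (LFibre E) k))) ∘ₗ
    CliffordAlgebra.contractLeft ((Module.finBasis ℂ (LFibre E)).coord k)

/-- The covector `dzⁱ` (for the linear coordinates `zⁱ` of a basis of `E`) as a linear form
on `L_x`; it vanishes on `T^{*(0,1)}`. -/
def dz (i : Fin (Module.finrank ℂ E)) : Module.Dual ℂ (LFibre E) :=
  (Module.finBasis ℂ E).coord i ∘ₗ LinearMap.fst ℂ E (E →L⋆[ℂ] ℂ)

/-- The covector `dz̄ʲ` as an element of `T^{*(0,1)}`. -/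
def dzbar (j : Fin (Module.finrank ℂ E)) : E →L⋆[ℂ] ℂ :=
  ((starL ℂ : ℂ ≃L⋆[ℂ] ℂ) : ℂ →L⋆[ℂ] ℂ).comp
    (LinearMap.toContinuousLinearMap ((Module.finBasis ℂ E).coord j))

end Fibre

section Flat

variable {E : Type*} [NormedAddCommGroup E] [NormedSpace ℂ E] [FiniteDimensional ℂ E]

/-- The Wirtinger derivative `∂s/∂zⁱ = (∂s/∂xⁱ - i ∂s/∂yⁱ) / 2`. -/
def dWirtinger (i : Fin (Module.finrank ℂ E)) (s : E → ExtL E) (y : E) : ExtL E :=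
  (1 / 2 : ℂ) • (fderiv ℝ s y (Module.finBasis ℂ E i) -
    Complex.I • fderiv ℝ s y (Complex.I • Module.finBasis ℂ E i))

/-- The Wirtinger derivative `∂s/∂z̄ʲ = (∂s/∂xʲ + i ∂s/∂yʲ) / 2`. -/
def dbarWirtinger (j : Fin (Module.finrank ℂ E)) (s : E → ExtL E) (y : E) : ExtL E :=
  (1 / 2 : ℂ) • (fderiv ℝ s y (Module.finBasis ℂ E j) +
    Complex.I • fderiv ℝ s y (Complex.I • Module.finBasis ℂ E j))

end Flat

section Manifold

variable {E : Type*} [NormedAddCommGroup E] [NormedSpace ℂ E]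
variable {M : Type*} [TopologicalSpace M] [ChartedSpace E M]

section

variable [IsManifold 𝓘(ℂ, E) 1 M]

/-- The coordinate change of the bundle `L` at the point `z`, from the trivialization of the
preferred chart at `x` to that of the preferred chart at `y`: on vectors it is the derivative `T` of
the coordinate change, on covectors it is `β ↦ β ∘ T⁻¹`. -/
def coordChangeL (x y z : M) : LFibre E →L[ℂ] LFibre E :=
  (tangentCoordChange 𝓘(ℂ, E) x y z).prodMap
    (ContinuousLinearMap.precomp ℂ (tangentCoordChange 𝓘(ℂ, E) y x z))

/-- The coordinate expression, in the preferred chart at `x`, of a section `s` of `∧^• L`. -/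
def localRep (x : M) (s : M → ExtL E) (y : E) : ExtL E :=
  let z := (extChartAt 𝓘(ℂ, E) x).symm y
  ExteriorAlgebra.map (coordChangeL z x z).toLinearMap (s z)

/-- The coordinate expression, in the preferred chart at `x`, of a section `φ` of `End L`. -/
def localRepEnd (x : M) (φ : M → LFibre E →L[ℂ] LFibre E) (y : E) : LFibre E →L[ℂ] LFibre E :=
  let z := (extChartAt 𝓘(ℂ, E) x).symm y
  (coordChangeL z x z).comp ((φ z).comp (coordChangeL x z z))

/-- `φ ∈ C^∞(M, End L) = C^∞(M, L* ⊗ L)`; smooth means `C^∞` in the real sense. -/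
def IsSmoothEnd (φ : M → LFibre E →L[ℂ] LFibre E) : Prop :=
  ∀ x : M, ContDiffOn ℝ ∞ (localRepEnd x φ) (extChartAt 𝓘(ℂ, E) x).target

variable [FiniteDimensional ℂ E]

/-- `s ∈ C^∞(M, ∧^• L)`; smooth means `C^∞` in the real sense. -/
def IsSmoothSection (s : M → ExtL E) : Prop :=
  ∀ x : M, ContDiffOn ℝ ∞ (localRep x s) (extChartAt 𝓘(ℂ, E) x).target

/-- The Lie algebroid differential `∂̄ : C^∞(∧^k L) → C^∞(∧^{k+1} L)` of `L̄ ≅ L*`. In holomorphic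
coordinates `∂̄P = ∑ⱼ dz̄ʲ ∧ ∂P/∂z̄ʲ`: the frame `∂/∂zⁱ, dz̄ʲ` of `L` is dual to the frame
`dzⁱ, ∂/∂z̄ʲ` of `L̄`, all Courant brackets inside the latter frame vanish, and its anchor is
`dzⁱ ↦ 0`, `∂/∂z̄ʲ ↦ ∂/∂z̄ʲ`. -/
def dbar (P : M → ExtL E) (x : M) : ExtL E :=
  ∑ j, ExteriorAlgebra.ι ℂ ((0, dzbar j) : LFibre E) *
    dbarWirtinger j (localRep x P) (extChartAt 𝓘(ℂ, E) x x)

/-- The Schouten bracket on `C^∞(∧^• L)`, that is the extension of the Courant bracket of `L` as a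
graded biderivation with `⟦X + α, f⟧ = X f` and `⟦f, g⟧ = 0`. In holomorphic coordinates
`⟦P, Q⟧ = ∑ᵢ (P ⌊ dzⁱ) ∧ ∂Q/∂zⁱ - ∂P/∂zⁱ ∧ (dzⁱ ⌋ Q)`: all Courant brackets inside the frame
`∂/∂zⁱ, dz̄ʲ` of `L` vanish, and its anchor is `∂/∂zⁱ ↦ ∂/∂zⁱ`, `dz̄ʲ ↦ 0`. On sections `X + α`
and `Y + β` of `L` this is `[X, Y] + 𝓛_X β - 𝓛_Y α`, the Courant bracket on the isotropic `L`. -/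
def schouten (P Q : M → ExtL E) (x : M) : ExtL E :=
  ∑ i, (CliffordAlgebra.contractRight (P x) (dz i) *
      dWirtinger i (localRep x Q) (extChartAt 𝓘(ℂ, E) x x) -
    dWirtinger i (localRep x P) (extChartAt 𝓘(ℂ, E) x x) *
      CliffordAlgebra.contractLeft (dz i) (Q x))

end

section

variable [FiniteDimensional ℂ E]

/-- The action of a section `φ` of `End L` on the sections of `∧^• L`. -/
def act (φ : M → LFibre E →L[ℂ] LFibre E) (A : M → ExtL E) (x : M) : ExtL E :=
  derivExt (φ x) (A x)

end

/-- A section `Γ` of `∧² L` and a section `φ` of `L* ⊗ L` form a compatible pair. -/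
structure IsCompatiblePair [IsManifold 𝓘(ℂ, E) 1 M] [FiniteDimensional ℂ E]
    (Γ : M → ExtL E) (φ : M → LFibre E →L[ℂ] LFibre E) : Prop where
  smooth_left : IsSmoothSection Γ
  degree_two : ∀ x, Γ x ∈ ⋀[ℂ]^2 (LFibre E)
  smooth_right : IsSmoothEnd φ
  dbar_closed : dbar Γ = 0
  dbar_act : ∀ A : M → ExtL E, IsSmoothSection A →
    dbar (act φ A) - act φ (dbar A) = schouten Γ A
  act_schouten : ∀ A B : M → ExtL E, IsSmoothSection A → IsSmoothSection B →
    schouten (act φ A) B + schouten A (act φ B) = act φ (schouten A B)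
  act_wedge : ∀ A B : M → ExtL E, IsSmoothSection A → IsSmoothSection B →
    act φ (A * B) = act φ A * B + A * act φ B

/-- The component `Λ` of `Γ` in `T^{2,0} = ∧² T^{1,0}`. -/
def bivectorPart (Γ : M → ExtL E) (x : M) : ExtL E :=
  ExteriorAlgebra.map (projT (E := E)).toLinearMap (Γ x)

/-- The component `Ω` of `Γ` in `T^{*(0,2)} = ∧² T^{*(0,1)}`. -/
def formPart (Γ : M → ExtL E) (x : M) : ExtL E :=
  ExteriorAlgebra.map (projTstar (E := E)).toLinearMap (Γ x)

/-- The component `Γ̂` of a section `Γ` of `∧² L` in `T^{1,0} ⊗ T^{*(0,1)}`, the remaining summand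
of `∧² L = T^{2,0} ⊕ (T^{1,0} ⊗ T^{*(0,1)}) ⊕ T^{*(0,2)}`. -/
def mixedPart (Γ : M → ExtL E) (x : M) : ExtL E :=
  Γ x - bivectorPart Γ x - formPart Γ x

/-- The block `φ₁` of `φ` in `End(T^{1,0}, T^{1,0})`. -/
def block₁ (φ : M → LFibre E →L[ℂ] LFibre E) (x : M) : LFibre E →L[ℂ] LFibre E :=
  projT.comp ((φ x).comp projT)

/-- The block `φ₂` of `φ` in `End(T^{*(0,1)}, T^{*(0,1)})`. -/
def block₂ (φ : M → LFibre E →L[ℂ] LFibre E) (x : M) : LFibre E →L[ℂ] LFibre E :=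
  projTstar.comp ((φ x).comp projTstar)

/-- The block `φ₃` of `φ` in `End(T^{1,0}, T^{*(0,1)})`. -/
def block₃ (φ : M → LFibre E →L[ℂ] LFibre E) (x : M) : LFibre E →L[ℂ] LFibre E :=
  projTstar.comp ((φ x).comp projT)

/-- The block `φ₄` of `φ` in `End(T^{*(0,1)}, T^{1,0})`. -/
def block₄ (φ : M → LFibre E →L[ℂ] LFibre E) (x : M) : LFibre E →L[ℂ] LFibre E :=
  projT.comp ((φ x).comp projTstar)

end Manifold

end ComplexDGA

end

/-! For `t ≠ 0`, multiplying `T^{1,0}` by `t` and fixing `T^{*(0,1)}` is an automorphism of the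
bundle `L`. It commutes with `∂̄` (`dbar_scaleExt`) and multiplies the Schouten bracket by a factor
`t` (`schouten_scaleExt`). Hence if `(Γ, φ)` is compatible, so is the pair formed by `t⁻¹` times the
scaled `Γ` and the conjugate of `φ` (`IsCompatiblePair.conj`).

Sorting by weight, this new pair is `t (Λ, φ₄) + (Γ̂, φ₁ + φ₂) + t⁻¹ (Ω, φ₃)`
(`scaleExt_of_degree_two`, `conjL_eq`). Compatibility is linear in the pair, since the product rule
holds for every `φ`; compatible pairs thus form a complex vector space (`IsCompatiblePair.add`,
`IsCompatiblePair.smul`). The values `t = 1, -1, i` suffice to isolate the three coefficients.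
Conversely, the three pairs add up to `(Γ, φ)`. -/

noncomputable section

namespace ComplexDGA

/-! ### Naturality of contractions. -/

section Contraction

variable {R V W : Type*} [CommRing R] [AddCommGroup V] [Module R V] [AddCommGroup W] [Module R W]

/-- Both sides vanish on scalars and obey the same recursion under left multiplication by a vector.
-/
theorem map_contractLeft (f : V →ₗ[R] W) (d : Module.Dual R W) (a : ExteriorAlgebra R V) :
    CliffordAlgebra.contractLeft d (ExteriorAlgebra.map f a) =
      ExteriorAlgebra.map f (CliffordAlgebra.contractLeft (d ∘ₗ f) a) := by
  induction a using CliffordAlgebra.left_induction with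
  | algebraMap r =>
    rw [AlgHom.commutes]
    erw [CliffordAlgebra.contractLeft_algebraMap, CliffordAlgebra.contractLeft_algebraMap]
    simp
  | add x y hx hy => simp only [map_add, hx, hy]
  | ι_mul x v hx =>
    rw [CliffordAlgebra.contractLeft_ι_mul, map_mul]
    erw [ExteriorAlgebra.map_apply_ι, CliffordAlgebra.contractLeft_ι_mul]
    rw [hx, map_sub, map_smul, map_mul]
    erw [ExteriorAlgebra.map_apply_ι]
    rfl

theorem map_contractRight (f : V →ₗ[R] W) (d : Module.Dual R W) (a : ExteriorAlgebra R V) :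
    CliffordAlgebra.contractRight (ExteriorAlgebra.map f a) d =
      ExteriorAlgebra.map f (CliffordAlgebra.contractRight a (d ∘ₗ f)) := by
  induction a using CliffordAlgebra.right_induction with
  | algebraMap r =>
    rw [AlgHom.commutes]
    erw [CliffordAlgebra.contractRight_algebraMap, CliffordAlgebra.contractRight_algebraMap]
    simp
  | add x y hx hy => simp only [map_add, LinearMap.add_apply, hx, hy]
  | mul_ι v x hx =>
    rw [CliffordAlgebra.contractRight_mul_ι, map_mul]
    erw [ExteriorAlgebra.map_apply_ι, CliffordAlgebra.contractRight_mul_ι]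
    rw [hx, map_sub, map_smul, map_mul]
    erw [ExteriorAlgebra.map_apply_ι]
    rfl

end Contraction

/-! ### Weights under the scaling of `T^{1,0}`, and derivations of the exterior algebra. -/

section Fibre

variable {E : Type*} [NormedAddCommGroup E] [NormedSpace ℂ E]

/-- The automorphism of `L_x` that multiplies `T^{1,0}` by `t` and fixes `T^{*(0,1)}`. -/
def scaleL (t : ℂ) : LFibre E →L[ℂ] LFibre E := t • projT + projTstar

@[simp] theorem projT_apply (a : LFibre E) : projT a = (a.1, 0) := rfl

@[simp] theorem projTstar_apply (a : LFibre E) : projTstar a = (0, a.2) := rfl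

@[simp] theorem scaleL_apply (t : ℂ) (a : LFibre E) : scaleL t a = (t • a.1, a.2) := by
  refine Prod.ext ?_ ?_
  · exact add_zero _
  · exact (congrArg (· + a.2) (smul_zero t)).trans (zero_add _)

theorem scaleL_comp_scaleL (s t : ℂ) :
    (scaleL s).comp (scaleL t) = (scaleL (s * t) : LFibre E →L[ℂ] LFibre E) := by
  ext a <;> simp [mul_smul]

theorem scaleL_one : (scaleL 1 : LFibre E →L[ℂ] LFibre E) = ContinuousLinearMap.id ℂ _ := by
  ext a <;> simp

/-- The automorphism of `∧^• L_x` induced by `scaleL t`. -/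
def scaleExt (t : ℂ) : ExtL E →ₐ[ℂ] ExtL E := ExteriorAlgebra.map (scaleL t).toLinearMap

theorem scaleExt_scaleExt {s t : ℂ} (h : s * t = 1) (a : ExtL E) :
    scaleExt s (scaleExt t a) = a := by
  have : ((scaleL s).toLinearMap ∘ₗ (scaleL t).toLinearMap : LFibre E →ₗ[ℂ] LFibre E)
      = LinearMap.id := by
    rw [← ContinuousLinearMap.toLinearMap_comp, scaleL_comp_scaleL, h, scaleL_one]; rfl
  rw [scaleExt, scaleExt, ← AlgHom.comp_apply, ExteriorAlgebra.map_comp_map, this,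
    ExteriorAlgebra.map_id]
  rfl

theorem map_mem_exteriorPower (f : LFibre E →ₗ[ℂ] LFibre E) (n : ℕ) {a : ExtL E}
    (ha : a ∈ ⋀[ℂ]^n (LFibre E)) : ExteriorAlgebra.map f a ∈ ⋀[ℂ]^n (LFibre E) := by
  rw [← ExteriorAlgebra.ιMulti_span_fixedDegree] at ha ⊢
  induction ha using Submodule.span_induction with
  | mem x hx =>
    obtain ⟨v, rfl⟩ := hx
    rw [ExteriorAlgebra.map_apply_ιMulti]
    exact Submodule.subset_span ⟨_, rfl⟩
  | zero => simp
  | add x y _ _ hx hy => rw [map_add]; exact add_mem hx hy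
  | smul c x _ hx => rw [map_smul]; exact Submodule.smul_mem _ c hx

/-- A bivector splits into components of weights `2`, `1` and `0` under `scaleExt`. -/
theorem scaleExt_of_degree_two (t : ℂ) {a : ExtL E} (ha : a ∈ ⋀[ℂ]^2 (LFibre E)) :
    scaleExt t a = t ^ 2 • ExteriorAlgebra.map (projT (E := E)).toLinearMap a +
      t • (a - ExteriorAlgebra.map (projT (E := E)).toLinearMap a -
        ExteriorAlgebra.map (projTstar (E := E)).toLinearMap a) +
      ExteriorAlgebra.map (projTstar (E := E)).toLinearMap a := by
  rw [← ExteriorAlgebra.ιMulti_span_fixedDegree] at ha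
  induction ha using Submodule.span_induction with
  | mem x hx =>
    obtain ⟨v, rfl⟩ := hx
    -- On a product of two vectors the mixed component is the sum of the two cross terms, each with
    -- exactly one factor in `T^{1,0}`.
    have key : ∀ u w : LFibre E,
        scaleExt t (ExteriorAlgebra.ι ℂ u * ExteriorAlgebra.ι ℂ w) =
        t ^ 2 • (ExteriorAlgebra.ι ℂ (projT u) * ExteriorAlgebra.ι ℂ (projT w)) +
        t • (ExteriorAlgebra.ι ℂ u * ExteriorAlgebra.ι ℂ w -
          ExteriorAlgebra.ι ℂ (projT u) * ExteriorAlgebra.ι ℂ (projT w) -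
          ExteriorAlgebra.ι ℂ (projTstar u) * ExteriorAlgebra.ι ℂ (projTstar w)) +
        ExteriorAlgebra.ι ℂ (projTstar u) * ExteriorAlgebra.ι ℂ (projTstar w) := by
      intro u w
      have hsplit : ∀ z : LFibre E, ExteriorAlgebra.ι ℂ z =
          ExteriorAlgebra.ι ℂ (projT z) + ExteriorAlgebra.ι ℂ (projTstar z) := by
        intro z
        rw [← map_add]
        congr 1
        ext <;> simp
      rw [scaleExt, map_mul, ExteriorAlgebra.map_apply_ι, ExteriorAlgebra.map_apply_ι, hsplit u,
        hsplit w]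
      have hs : ∀ z : LFibre E, ExteriorAlgebra.ι ℂ ((scaleL t).toLinearMap z) =
          t • ExteriorAlgebra.ι ℂ (projT z) + ExteriorAlgebra.ι ℂ (projTstar z) := by
        intro z
        rw [← map_smul, ← map_add]
        rfl
      rw [hs, hs]
      simp only [add_mul, mul_add, smul_mul_assoc, mul_smul_comm, smul_add, smul_sub, smul_smul,
        pow_two]
      abel
    have hmul : ∀ w : Fin 2 → LFibre E, ExteriorAlgebra.ιMulti ℂ 2 w =
        ExteriorAlgebra.ι ℂ (w 0) * ExteriorAlgebra.ι ℂ (w 1) := by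
      intro w
      simp [ExteriorAlgebra.ιMulti_apply]
      rfl
    rw [ExteriorAlgebra.map_apply_ιMulti, ExteriorAlgebra.map_apply_ιMulti, hmul, hmul, hmul]
    exact key (v 0) (v 1)
  | zero => simp
  | add x y _ _ hx hy => simp only [map_add, hx, hy, smul_add, smul_sub]; abel
  | smul c x _ hx =>
    simp only [map_smul, hx, smul_add, smul_sub, smul_comm c]

/-- The conjugate of an endomorphism of `L_x` by `scaleL t`. -/
def conjL (t : ℂ) (φ : LFibre E →L[ℂ] LFibre E) : LFibre E →L[ℂ] LFibre E :=
  (scaleL t).comp (φ.comp (scaleL t⁻¹))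

/-- A block gains `t` when its target is `T^{1,0}` and `t⁻¹` when its source is; in `φ₁` the two
cancel. These weights match those of `Λ`, `Γ̂`, `Ω` after division by `t`. -/
theorem conjL_eq {t : ℂ} (ht : t ≠ 0) (φ : LFibre E →L[ℂ] LFibre E) :
    conjL t φ = t • projT.comp (φ.comp projTstar) + (projT.comp (φ.comp projT) +
      projTstar.comp (φ.comp projTstar)) + t⁻¹ • projTstar.comp (φ.comp projT) := by
  refine ContinuousLinearMap.ext fun a => ?_
  have h1 : φ (t⁻¹ • a.1, a.2) = t⁻¹ • φ (a.1, 0) + φ (0, a.2) := by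
    rw [← map_smul, ← map_add]
    congr 1
    exact Prod.ext (add_zero _).symm ((congrArg (· + a.2) (smul_zero t⁻¹)).trans (zero_add _)).symm
  have h2 : t • t⁻¹ • (φ (a.1, 0)).1 = (φ (a.1, 0)).1 := smul_inv_smul₀ ht _
  simp only [conjL, ContinuousLinearMap.comp_apply, scaleL_apply, h1, projT_apply, projTstar_apply,
    add_apply, smul_apply]
  ext <;> simp [h2, add_comm]

variable [FiniteDimensional ℂ E]

theorem derivExt_algebraMap (φ : LFibre E →L[ℂ] LFibre E) (r : ℂ) :
    derivExt φ (algebraMap ℂ (ExtL E) r) = 0 := by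
  simp only [derivExt, LinearMap.sum_apply, LinearMap.comp_apply]
  refine Finset.sum_eq_zero fun k _ => ?_
  erw [CliffordAlgebra.contractLeft_algebraMap]
  simp

/-- Contraction is an antiderivation: its first term reassembles `φ v` from the basis, and the sign
of its second is absorbed by swapping `φ eₖ` with `v`. -/
theorem derivExt_ι_mul (φ : LFibre E →L[ℂ] LFibre E) (v : LFibre E) (a : ExtL E) :
    derivExt φ (ExteriorAlgebra.ι ℂ v * a) =
      ExteriorAlgebra.ι ℂ (φ v) * a + ExteriorAlgebra.ι ℂ v * derivExt φ a := by
  have hv : φ v = ∑ k, (Module.finBasis ℂ (LFibre E)).coord k v •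
      φ (Module.finBasis ℂ (LFibre E) k) := by
    conv_lhs => rw [← (Module.finBasis ℂ (LFibre E)).sum_repr v]
    rw [map_sum]
    simp only [map_smul, Module.Basis.coord_apply]
  rw [hv]
  simp only [derivExt, LinearMap.sum_apply, LinearMap.comp_apply, map_sum, Finset.sum_mul,
    Finset.mul_sum, ← Finset.sum_add_distrib]
  refine Finset.sum_congr rfl fun k _ => ?_
  have h := CliffordAlgebra.contractLeft_ι_mul (Q := (0 : QuadraticForm ℂ (LFibre E)))
    ((Module.finBasis ℂ (LFibre E)).coord k) v a
  erw [h]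
  have hswap := ExteriorAlgebra.ι_add_mul_swap (R := ℂ) (φ (Module.finBasis ℂ (LFibre E) k)) v
  rw [LinearMap.mulLeft_apply, LinearMap.mulLeft_apply, mul_sub, map_smul, mul_smul_comm,
    smul_mul_assoc, sub_eq_add_neg]
  congr 1
  rw [← mul_assoc, ← mul_assoc, ← neg_mul]
  congr 1
  exact neg_eq_of_add_eq_zero_right hswap

theorem derivExt_mul (φ : LFibre E →L[ℂ] LFibre E) (a b : ExtL E) :
    derivExt φ (a * b) = derivExt φ a * b + a * derivExt φ b := by
  induction a using CliffordAlgebra.left_induction with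
  | algebraMap r =>
    erw [derivExt_algebraMap]
    rw [zero_mul, zero_add, ← Algebra.smul_def, ← Algebra.smul_def, map_smul]
  | add x y hx hy => rw [add_mul, map_add, map_add, hx, hy, add_mul, add_mul]; abel
  | ι_mul x v hx =>
    rw [mul_assoc]
    erw [derivExt_ι_mul, derivExt_ι_mul]
    rw [hx]
    simp only [mul_add, add_mul, mul_assoc, add_assoc]

/-- Serves both coordinate changes, where it gives the local form of the action, and scaling. -/
theorem map_derivExt {f φ ψ : LFibre E →L[ℂ] LFibre E} (h : f.comp φ = ψ.comp f) (a : ExtL E) :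
    ExteriorAlgebra.map f.toLinearMap (derivExt φ a) =
      derivExt ψ (ExteriorAlgebra.map f.toLinearMap a) := by
  induction a using CliffordAlgebra.left_induction with
  | algebraMap r =>
    erw [derivExt_algebraMap]
    rw [AlgHom.commutes, derivExt_algebraMap, map_zero]
  | add x y hx hy => simp only [map_add, hx, hy]
  | ι_mul x v hx =>
    have hv : f (φ v) = ψ (f v) := DFunLike.congr_fun h v
    erw [derivExt_ι_mul]
    rw [map_add, map_mul, map_mul, map_mul]
    erw [ExteriorAlgebra.map_apply_ι, ExteriorAlgebra.map_apply_ι]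
    rw [derivExt_ι_mul, hx]
    erw [hv]
    rfl

theorem derivExt_add (φ ψ : LFibre E →L[ℂ] LFibre E) (a : ExtL E) :
    derivExt (φ + ψ) a = derivExt φ a + derivExt ψ a := by
  simp [derivExt, add_mul, Finset.sum_add_distrib]

theorem derivExt_smul (c : ℂ) (φ : LFibre E →L[ℂ] LFibre E) (a : ExtL E) :
    derivExt (c • φ) a = c • derivExt φ a := by
  simp [derivExt, Finset.smul_sum]

/-- `derivExt` as a continuous linear map. -/
def derivExtL : (LFibre E →L[ℂ] LFibre E) →L[ℂ] (ExtL E →L[ℂ] ExtL E) :=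
  LinearMap.toContinuousLinearMap (𝕜 := ℂ) (E := LFibre E →L[ℂ] LFibre E)
    (F' := ExtL E →L[ℂ] ExtL E)
    { toFun := fun φ => LinearMap.toContinuousLinearMap (𝕜 := ℂ) (E := ExtL E) (F' := ExtL E)
        (derivExt φ)
      map_add' := fun φ ψ => ContinuousLinearMap.ext fun a => derivExt_add φ ψ a
      map_smul' := fun c φ => ContinuousLinearMap.ext fun a => derivExt_smul c φ a }

theorem dz_comp_scaleL (t : ℂ) (i : Fin (Module.finrank ℂ E)) :
    dz i ∘ₗ (scaleL t : LFibre E →L[ℂ] LFibre E).toLinearMap = t • dz i := by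
  ext a <;> simp [dz]

/-- The form `dzⁱ` sees only `T^{1,0}`, so pulling it back along the scaling multiplies it by `t`.
-/
theorem contractLeft_scaleExt (t : ℂ) (i : Fin (Module.finrank ℂ E)) (a : ExtL E) :
    CliffordAlgebra.contractLeft (dz i) (scaleExt t a) =
      t • scaleExt t (CliffordAlgebra.contractLeft (dz i) a) := by
  rw [scaleExt, map_contractLeft, dz_comp_scaleL, map_smul, LinearMap.smul_apply, map_smul]

theorem contractRight_scaleExt (t : ℂ) (i : Fin (Module.finrank ℂ E)) (a : ExtL E) :
    CliffordAlgebra.contractRight (scaleExt t a) (dz i) =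
      t • scaleExt t (CliffordAlgebra.contractRight a (dz i)) := by
  rw [scaleExt, map_contractRight, dz_comp_scaleL, map_smul, map_smul]

end Fibre

/-! ### Wirtinger derivatives and constant linear maps. -/

section Flat

variable {E : Type*} [NormedAddCommGroup E] [NormedSpace ℂ E] [FiniteDimensional ℂ E]

/-- `scaleExt` as a continuous linear map. -/
def scaleExtL (t : ℂ) : ExtL E →L[ℂ] ExtL E :=
  LinearMap.toContinuousLinearMap (𝕜 := ℂ) (E := ExtL E) (F' := ExtL E) (scaleExt t).toLinearMap

@[simp] theorem scaleExtL_apply (t : ℂ) (a : ExtL E) : scaleExtL t a = scaleExt t a := rfl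

theorem fderiv_clm_comp (T : ExtL E →L[ℂ] ExtL E) {s : E → ExtL E} {y : E}
    (hs : DifferentiableAt ℝ s y) (v : E) :
    fderiv ℝ (fun z => T (s z)) y v = T (fderiv ℝ s y v) := by
  have h : HasFDerivAt (fun z => T (s z)) ((T.restrictScalars ℝ).comp (fderiv ℝ s y)) y :=
    (T.restrictScalars ℝ).hasFDerivAt.comp y hs.hasFDerivAt
  rw [h.fderiv]
  rfl

theorem dWirtinger_clm_comp (T : ExtL E →L[ℂ] ExtL E) (i : Fin (Module.finrank ℂ E))
    {s : E → ExtL E} {y : E} (hs : DifferentiableAt ℝ s y) :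
    dWirtinger i (fun z => T (s z)) y = T (dWirtinger i s y) := by
  simp only [dWirtinger, fderiv_clm_comp T hs, map_smul, map_sub]

theorem dbarWirtinger_clm_comp (T : ExtL E →L[ℂ] ExtL E) (i : Fin (Module.finrank ℂ E))
    {s : E → ExtL E} {y : E} (hs : DifferentiableAt ℝ s y) :
    dbarWirtinger i (fun z => T (s z)) y = T (dbarWirtinger i s y) := by
  simp only [dbarWirtinger, fderiv_clm_comp T hs, map_smul, map_add]

theorem dWirtinger_add (i : Fin (Module.finrank ℂ E)) {s r : E → ExtL E} {y : E}
    (hs : DifferentiableAt ℝ s y) (hr : DifferentiableAt ℝ r y) :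
    dWirtinger i (fun z => s z + r z) y = dWirtinger i s y + dWirtinger i r y := by
  simp only [dWirtinger, fderiv_fun_add hs hr, add_apply, smul_add, smul_sub]
  abel

theorem dbarWirtinger_add (i : Fin (Module.finrank ℂ E)) {s r : E → ExtL E} {y : E}
    (hs : DifferentiableAt ℝ s y) (hr : DifferentiableAt ℝ r y) :
    dbarWirtinger i (fun z => s z + r z) y = dbarWirtinger i s y + dbarWirtinger i r y := by
  simp only [dbarWirtinger, fderiv_fun_add hs hr, add_apply, smul_add]
  abel

end Flat

/-! ### Coordinate expressions and smoothness. -/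

section Manifold

variable {E : Type*} [NormedAddCommGroup E] [NormedSpace ℂ E]
variable {M : Type*} [TopologicalSpace M] [ChartedSpace E M] [IsManifold 𝓘(ℂ, E) 1 M]

/-- Coordinate changes are complex linear and block diagonal, so the scaling does not depend on the
chart. -/
theorem scaleL_comp_coordChangeL (t : ℂ) (x y z : M) :
    (scaleL t).comp (coordChangeL x y z) =
      (coordChangeL x y z).comp (scaleL t : LFibre E →L[ℂ] LFibre E) := by
  refine ContinuousLinearMap.ext fun a => ?_
  simp [coordChangeL]

theorem coordChangeL_comp_coordChangeL {x y z : M}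
    (hx : z ∈ (extChartAt 𝓘(ℂ, E) x).source) (hy : z ∈ (extChartAt 𝓘(ℂ, E) y).source) :
    (coordChangeL y x z).comp (coordChangeL x y z) = ContinuousLinearMap.id ℂ (LFibre E) := by
  have key : ∀ {x y : M}, z ∈ (extChartAt 𝓘(ℂ, E) x).source →
      z ∈ (extChartAt 𝓘(ℂ, E) y).source → ∀ v : E,
      tangentCoordChange 𝓘(ℂ, E) y x z (tangentCoordChange 𝓘(ℂ, E) x y z v) = v := by
    intro x y hx hy v
    rw [tangentCoordChange_comp ⟨⟨hx, hy⟩, hx⟩, tangentCoordChange_self hx]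
  refine ContinuousLinearMap.ext fun a => Prod.ext (key hx hy a.1) ?_
  refine ContinuousLinearMap.ext fun v => ?_
  exact congrArg a.2 (key hx hy v)

theorem localRep_add (x : M) (s r : M → ExtL E) :
    localRep x (s + r) = fun y => localRep x s y + localRep x r y := by
  ext y
  simp [localRep]

theorem localRep_smul (x : M) (c : ℂ) (s : M → ExtL E) :
    localRep x (c • s) = fun y => c • localRep x s y := by
  ext y
  simp [localRep]

theorem localRep_scaleExt (x : M) (t : ℂ) (s : M → ExtL E) :
    localRep x (fun z => scaleExt t (s z)) = fun y => scaleExt t (localRep x s y) := by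
  ext y
  simp only [localRep, scaleExt]
  rw [← AlgHom.comp_apply, ← AlgHom.comp_apply, ExteriorAlgebra.map_comp_map,
    ExteriorAlgebra.map_comp_map, ← ContinuousLinearMap.toLinearMap_comp,
    ← ContinuousLinearMap.toLinearMap_comp, scaleL_comp_coordChangeL]

theorem localRepEnd_add (x : M) (φ ψ : M → LFibre E →L[ℂ] LFibre E) :
    localRepEnd x (φ + ψ) = fun y => localRepEnd x φ y + localRepEnd x ψ y := by
  ext1 y
  simp [localRepEnd, ContinuousLinearMap.add_comp, ContinuousLinearMap.comp_add]

theorem localRepEnd_smul (x : M) (c : ℂ) (φ : M → LFibre E →L[ℂ] LFibre E) :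
    localRepEnd x (c • φ) = fun y => c • localRepEnd x φ y := by
  ext1 y
  simp [localRepEnd, ContinuousLinearMap.smul_comp]

theorem localRepEnd_conjL (x : M) (t : ℂ) (φ : M → LFibre E →L[ℂ] LFibre E) :
    localRepEnd x (fun z => conjL t (φ z)) = fun y => conjL t (localRepEnd x φ y) := by
  ext1 y
  simp only [localRepEnd, conjL]
  refine ContinuousLinearMap.ext fun a => ?_
  have h := fun (t : ℂ) (p q r : M) (b : LFibre E) =>
    DFunLike.congr_fun (scaleL_comp_coordChangeL t p q r) b
  simp only [ContinuousLinearMap.comp_apply] at h ⊢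
  rw [← h, ← h]

theorem IsSmoothEnd.add {φ ψ : M → LFibre E →L[ℂ] LFibre E} (hφ : IsSmoothEnd φ)
    (hψ : IsSmoothEnd ψ) : IsSmoothEnd (φ + ψ) := fun x => by
  rw [localRepEnd_add]
  exact (hφ x).add (hψ x)

theorem IsSmoothEnd.smul (c : ℂ) {φ : M → LFibre E →L[ℂ] LFibre E} (hφ : IsSmoothEnd φ) :
    IsSmoothEnd (c • φ) := fun x => by
  rw [localRepEnd_smul]
  exact (hφ x).const_smul c

theorem IsSmoothEnd.conjL (t : ℂ) {φ : M → LFibre E →L[ℂ] LFibre E} (hφ : IsSmoothEnd φ) :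
    IsSmoothEnd (fun z => conjL t (φ z)) := fun x => by
  rw [localRepEnd_conjL]
  let T := ((ContinuousLinearMap.compL ℂ (LFibre E) (LFibre E) (LFibre E)) (scaleL t)).comp
    ((ContinuousLinearMap.compL ℂ (LFibre E) (LFibre E) (LFibre E)).flip (scaleL t⁻¹))
  have h : ContDiff ℝ ∞ fun p : LFibre E →L[ℂ] LFibre E => T.restrictScalars ℝ p :=
    ContinuousLinearMap.contDiff _
  exact h.comp_contDiffOn (hφ x)

variable [FiniteDimensional ℂ E]

theorem IsSmoothSection.add {s r : M → ExtL E} (hs : IsSmoothSection s)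
    (hr : IsSmoothSection r) : IsSmoothSection (s + r) := fun x => by
  rw [localRep_add]
  exact (hs x).add (hr x)

theorem IsSmoothSection.smul (c : ℂ) {s : M → ExtL E} (hs : IsSmoothSection s) :
    IsSmoothSection (c • s) := fun x => by
  rw [localRep_smul]
  exact (hs x).const_smul c

theorem IsSmoothSection.scaleExt (t : ℂ) {s : M → ExtL E} (hs : IsSmoothSection s) :
    IsSmoothSection (fun z => scaleExt t (s z)) := fun x => by
  rw [localRep_scaleExt]
  exact ((scaleExtL t).restrictScalars ℝ).contDiff.comp_contDiffOn (hs x)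

/-- Licenses the linearity rules for `fderiv`, and so for `dbar` and `schouten`. -/
theorem IsSmoothSection.differentiableAt {s : M → ExtL E} (hs : IsSmoothSection s) (x : M) :
    DifferentiableAt ℝ (localRep x s) (extChartAt 𝓘(ℂ, E) x x) :=
  ((hs x).differentiableOn (by simp)).differentiableAt (extChartAt_target_mem_nhds x)

theorem localRep_act (x : M) (φ : M → LFibre E →L[ℂ] LFibre E) (s : M → ExtL E) {y : E}
    (hy : y ∈ (extChartAt 𝓘(ℂ, E) x).target) :
    localRep x (act φ s) y = derivExt (localRepEnd x φ y) (localRep x s y) := by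
  refine map_derivExt ?_ _
  have hz := (extChartAt 𝓘(ℂ, E) x).map_target hy
  rw [localRepEnd, ContinuousLinearMap.comp_assoc, ContinuousLinearMap.comp_assoc,
    coordChangeL_comp_coordChangeL (mem_extChartAt_source _) hz, ContinuousLinearMap.comp_id]

theorem IsSmoothSection.act {φ : M → LFibre E →L[ℂ] LFibre E} {s : M → ExtL E}
    (hφ : IsSmoothEnd φ) (hs : IsSmoothSection s) : IsSmoothSection (act φ s) := fun x => by
  refine ContDiffOn.congr ?_ fun y hy => localRep_act x φ s hy
  have h : ContDiff ℝ ∞ fun p : LFibre E →L[ℂ] LFibre E =>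
      ContinuousLinearMap.restrictScalarsL ℂ (ExtL E) (ExtL E) ℝ ℝ
        ((derivExtL (E := E)).restrictScalars ℝ p) :=
    (ContinuousLinearMap.contDiff _).comp (ContinuousLinearMap.contDiff _)
  exact (h.comp_contDiffOn (hφ x)).clm_apply (hs x)

end Manifold

/-! ### Linearity and scaling behaviour of the action, `∂̄` and the Schouten bracket. -/

section Manifold

variable {E : Type*} [NormedAddCommGroup E] [NormedSpace ℂ E] [FiniteDimensional ℂ E]
variable {M : Type*}

theorem act_add_left (φ ψ : M → LFibre E →L[ℂ] LFibre E) (A : M → ExtL E) :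
    act (φ + ψ) A = act φ A + act ψ A :=
  funext fun _ => derivExt_add _ _ _

theorem act_smul_left (c : ℂ) (φ : M → LFibre E →L[ℂ] LFibre E) (A : M → ExtL E) :
    act (c • φ) A = c • act φ A :=
  funext fun _ => derivExt_smul _ _ _

theorem act_smul_right (c : ℂ) (φ : M → LFibre E →L[ℂ] LFibre E) (A : M → ExtL E) :
    act φ (c • A) = c • act φ A :=
  funext fun x => (derivExt (φ x)).map_smul c (A x)

theorem act_mul (φ : M → LFibre E →L[ℂ] LFibre E) (A B : M → ExtL E) :
    act φ (A * B) = act φ A * B + A * act φ B :=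
  funext fun _ => derivExt_mul _ _ _

theorem act_scaleExt {t : ℂ} (ht : t ≠ 0) (φ : M → LFibre E →L[ℂ] LFibre E) (A : M → ExtL E) :
    act (fun z => conjL t (φ z)) (fun z => scaleExt t (A z)) =
      fun z => scaleExt t (act φ A z) := by
  funext z
  have h : (scaleL t).comp (φ z) = (conjL t (φ z)).comp (scaleL t) := by
    rw [conjL, ContinuousLinearMap.comp_assoc, ContinuousLinearMap.comp_assoc, scaleL_comp_scaleL,
      inv_mul_cancel₀ ht, scaleL_one, ContinuousLinearMap.comp_id]
  exact (map_derivExt h _).symm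

variable [TopologicalSpace M] [ChartedSpace E M] [IsManifold 𝓘(ℂ, E) 1 M]

theorem dbar_add {A B : M → ExtL E} (hA : IsSmoothSection A) (hB : IsSmoothSection B) :
    dbar (A + B) = dbar A + dbar B := by
  funext x
  simp only [dbar, Pi.add_apply, localRep_add,
    dbarWirtinger_add _ (hA.differentiableAt x) (hB.differentiableAt x), mul_add,
    Finset.sum_add_distrib]

theorem dbar_smul (c : ℂ) {A : M → ExtL E} (hA : IsSmoothSection A) :
    dbar (c • A) = c • dbar A := by
  funext x
  have h := fun i => dbarWirtinger_clm_comp (c • ContinuousLinearMap.id ℂ (ExtL E)) i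
    (hA.differentiableAt x)
  simp only [smul_apply, ContinuousLinearMap.id_apply] at h
  simp only [dbar, Pi.smul_apply, localRep_smul, h, mul_smul_comm, Finset.smul_sum]

/-- The scaling has constant coefficients, hence commutes with `∂/∂z̄ʲ`, and it fixes `dz̄ʲ`. -/
theorem dbar_scaleExt (t : ℂ) {A : M → ExtL E} (hA : IsSmoothSection A) :
    dbar (fun z => scaleExt t (A z)) = fun z => scaleExt t (dbar A z) := by
  funext x
  have h := fun i => dbarWirtinger_clm_comp (scaleExtL t) i (hA.differentiableAt x)
  simp only [scaleExtL_apply] at h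
  have hι : ∀ j, scaleExt t (ExteriorAlgebra.ι ℂ ((0, dzbar j) : LFibre E)) =
      ExteriorAlgebra.ι ℂ ((0, dzbar j) : LFibre E) := by
    intro j
    refine (ExteriorAlgebra.map_apply_ι _ _).trans (congrArg _ ?_)
    exact (scaleL_apply t _).trans (congrArg (·, dzbar j) (smul_zero t))
  simp only [dbar, localRep_scaleExt, h, map_sum, map_mul, hι]

theorem schouten_add_left {A B : M → ExtL E} (C : M → ExtL E) (hA : IsSmoothSection A)
    (hB : IsSmoothSection B) : schouten (A + B) C = schouten A C + schouten B C := by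
  funext x
  simp only [schouten, Pi.add_apply, localRep_add,
    dWirtinger_add _ (hA.differentiableAt x) (hB.differentiableAt x), add_mul, map_add,
    LinearMap.add_apply, ← Finset.sum_add_distrib]
  exact Finset.sum_congr rfl fun i _ => by abel

theorem schouten_add_right (C : M → ExtL E) {A B : M → ExtL E} (hA : IsSmoothSection A)
    (hB : IsSmoothSection B) : schouten C (A + B) = schouten C A + schouten C B := by
  funext x
  simp only [schouten, Pi.add_apply, localRep_add,
    dWirtinger_add _ (hA.differentiableAt x) (hB.differentiableAt x), mul_add, map_add,
    ← Finset.sum_add_distrib]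
  exact Finset.sum_congr rfl fun i _ => by abel

theorem schouten_smul_left (c : ℂ) {A : M → ExtL E} (C : M → ExtL E) (hA : IsSmoothSection A) :
    schouten (c • A) C = c • schouten A C := by
  funext x
  have h := fun i => dWirtinger_clm_comp (c • ContinuousLinearMap.id ℂ (ExtL E)) i
    (hA.differentiableAt x)
  simp only [smul_apply, ContinuousLinearMap.id_apply] at h
  simp only [schouten, Pi.smul_apply, localRep_smul, h, map_smul, LinearMap.smul_apply,
    smul_mul_assoc, Finset.smul_sum, smul_sub]

theorem schouten_smul_right (c : ℂ) (C : M → ExtL E) {A : M → ExtL E} (hA : IsSmoothSection A) :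
    schouten C (c • A) = c • schouten C A := by
  funext x
  have h := fun i => dWirtinger_clm_comp (c • ContinuousLinearMap.id ℂ (ExtL E)) i
    (hA.differentiableAt x)
  simp only [smul_apply, ContinuousLinearMap.id_apply] at h
  simp only [schouten, Pi.smul_apply, localRep_smul, h, map_smul,
    mul_smul_comm, Finset.smul_sum, smul_sub]

/-- The Schouten bracket has weight `-1` with respect to the grading by the degree in `T^{1,0}`. -/
theorem schouten_scaleExt (t : ℂ) {A B : M → ExtL E} (hA : IsSmoothSection A)
    (hB : IsSmoothSection B) :
    schouten (fun z => scaleExt t (A z)) (fun z => scaleExt t (B z)) =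
      t • fun z => scaleExt t (schouten A B z) := by
  funext x
  have h := fun (C : M → ExtL E) (hC : IsSmoothSection C) i =>
    dWirtinger_clm_comp (scaleExtL t) i (hC.differentiableAt x)
  simp only [scaleExtL_apply] at h
  -- Each term contains exactly one contraction with `dzⁱ`, hence exactly one factor `t`.
  simp only [schouten, localRep_scaleExt, h A hA, h B hB, contractRight_scaleExt,
    contractLeft_scaleExt, Pi.smul_apply, map_sum, map_sub, map_mul, smul_mul_assoc, mul_smul_comm,
    Finset.smul_sum, smul_sub]

/-- Lets identities over all smooth sections be tested on scaled ones. -/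
theorem exists_scaleExt {t : ℂ} (ht : t ≠ 0) {A : M → ExtL E} (hA : IsSmoothSection A) :
    ∃ B : M → ExtL E, IsSmoothSection B ∧ (fun z => scaleExt t (B z)) = A :=
  ⟨_, hA.scaleExt t⁻¹, funext fun _ => scaleExt_scaleExt (mul_inv_cancel₀ ht) _⟩

/-! ### The vector space of compatible pairs and its scaling symmetry. -/

namespace IsCompatiblePair

variable {Γ Δ : M → ExtL E} {φ ψ : M → LFibre E →L[ℂ] LFibre E}

theorem add (h : IsCompatiblePair Γ φ) (k : IsCompatiblePair Δ ψ) :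
    IsCompatiblePair (Γ + Δ) (φ + ψ) where
  smooth_left := h.smooth_left.add k.smooth_left
  degree_two x := add_mem (h.degree_two x) (k.degree_two x)
  smooth_right := h.smooth_right.add k.smooth_right
  dbar_closed := by
    rw [dbar_add h.smooth_left k.smooth_left, h.dbar_closed, k.dbar_closed, add_zero]
  dbar_act A hA := by
    rw [act_add_left, act_add_left, dbar_add (hA.act h.smooth_right) (hA.act k.smooth_right),
      schouten_add_left _ h.smooth_left k.smooth_left, ← h.dbar_act A hA, ← k.dbar_act A hA]
    abel
  act_schouten A B hA hB := by
    simp only [act_add_left]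
    rw [schouten_add_left _ (hA.act h.smooth_right) (hA.act k.smooth_right),
      schouten_add_right _ (hB.act h.smooth_right) (hB.act k.smooth_right),
      ← h.act_schouten A B hA hB, ← k.act_schouten A B hA hB]
    abel
  act_wedge A B _ _ := act_mul _ A B

theorem smul (c : ℂ) (h : IsCompatiblePair Γ φ) : IsCompatiblePair (c • Γ) (c • φ) where
  smooth_left := h.smooth_left.smul c
  degree_two x := Submodule.smul_mem _ c (h.degree_two x)
  smooth_right := h.smooth_right.smul c
  dbar_closed := by rw [dbar_smul c h.smooth_left, h.dbar_closed, smul_zero]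
  dbar_act A hA := by
    rw [act_smul_left, act_smul_left, dbar_smul c (hA.act h.smooth_right),
      schouten_smul_left c _ h.smooth_left, ← h.dbar_act A hA, smul_sub]
  act_schouten A B hA hB := by
    simp only [act_smul_left]
    rw [schouten_smul_left c _ (hA.act h.smooth_right),
      schouten_smul_right c _ (hB.act h.smooth_right), ← h.act_schouten A B hA hB, smul_add]
  act_wedge A B _ _ := act_mul _ A B

/-- Compatibility is invariant under the scaling of `T^{1,0}`, under which the Schouten bracket is
multiplied by a factor. -/
theorem conj (h : IsCompatiblePair Γ φ) {t : ℂ} (ht : t ≠ 0) :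
    IsCompatiblePair (t⁻¹ • fun z => scaleExt t (Γ z)) (fun z => conjL t (φ z)) where
  smooth_left := (h.smooth_left.scaleExt t).smul t⁻¹
  degree_two x := Submodule.smul_mem _ t⁻¹ (map_mem_exteriorPower _ 2 (h.degree_two x))
  smooth_right := h.smooth_right.conjL t
  dbar_closed := by
    rw [dbar_smul _ (h.smooth_left.scaleExt t), dbar_scaleExt t h.smooth_left, h.dbar_closed]
    funext x
    simp
  dbar_act A hA := by
    obtain ⟨B, hB, rfl⟩ := exists_scaleExt ht hA
    -- The prefactor `t⁻¹` of `Γ` cancels the factor `t` produced by the bracket.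
    rw [act_scaleExt ht, dbar_scaleExt t (hB.act h.smooth_right), dbar_scaleExt t hB,
      act_scaleExt ht, schouten_smul_left _ _ (h.smooth_left.scaleExt t),
      schouten_scaleExt t h.smooth_left hB, inv_smul_smul₀ ht, ← h.dbar_act B hB]
    funext x
    simp
  act_schouten A B hA hB := by
    obtain ⟨C, hC, rfl⟩ := exists_scaleExt ht hA
    obtain ⟨D, hD, rfl⟩ := exists_scaleExt ht hB
    -- Every term contains one bracket, so the same factor `t` appears on both sides.
    rw [act_scaleExt ht, act_scaleExt ht, schouten_scaleExt t (hC.act h.smooth_right) hD,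
      schouten_scaleExt t hC (hD.act h.smooth_right), schouten_scaleExt t hC hD, act_smul_right,
      act_scaleExt ht, ← h.act_schouten C D hC hD]
    funext x
    simp
  act_wedge A B _ _ := act_mul _ A B

end IsCompatiblePair

end Manifold

end ComplexDGA

end

/-! ### The proposition. -/

theorem proposition4p1
    {E : Type*} [NormedAddCommGroup E] [NormedSpace ℂ E] [FiniteDimensional ℂ E]
    {M : Type*} [TopologicalSpace M] [ChartedSpace E M] [IsManifold 𝓘(ℂ, E) 1 M]
    (Γ₁ : M → ComplexDGA.ExtL E) (φ : M → ComplexDGA.LFibre E →L[ℂ] ComplexDGA.LFibre E)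
    (hΓ_smooth : ComplexDGA.IsSmoothSection Γ₁)
    (hΓ_deg : ∀ x, Γ₁ x ∈ ⋀[ℂ]^2 (ComplexDGA.LFibre E))
    (hφ_smooth : ComplexDGA.IsSmoothEnd φ) :
    ComplexDGA.IsCompatiblePair Γ₁ φ ↔
      ComplexDGA.IsCompatiblePair (ComplexDGA.bivectorPart Γ₁) (ComplexDGA.block₄ φ) ∧
      ComplexDGA.IsCompatiblePair (ComplexDGA.formPart Γ₁) (ComplexDGA.block₃ φ) ∧
      ComplexDGA.IsCompatiblePair (ComplexDGA.mixedPart Γ₁)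
        (ComplexDGA.block₁ φ + ComplexDGA.block₂ φ) := by
  constructor
  · intro h
    have hw : ∀ t : ℂ, t ≠ 0 → ComplexDGA.IsCompatiblePair
        (t • ComplexDGA.bivectorPart Γ₁ + ComplexDGA.mixedPart Γ₁ +
          t⁻¹ • ComplexDGA.formPart Γ₁)
        (t • ComplexDGA.block₄ φ + (ComplexDGA.block₁ φ + ComplexDGA.block₂ φ) +
          t⁻¹ • ComplexDGA.block₃ φ) := by
      intro t ht
      convert h.conj ht using 1
      · funext x
        simp only [Pi.smul_apply, Pi.add_apply, ComplexDGA.scaleExt_of_degree_two t (hΓ_deg x),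
          smul_add, pow_two, mul_smul, inv_smul_smul₀ ht]
        rfl
      · funext x
        exact (ComplexDGA.conjL_eq ht (φ x)).symm
    -- The values `±1` only separate the middle coefficient from the sum of the outer ones; `t = i`,
    -- where `t⁻¹ = -t`, separates those two.
    have h1 := hw 1 one_ne_zero
    have h2 := hw (-1) (by norm_num)
    have h3 := hw Complex.I Complex.I_ne_zero
    generalize ComplexDGA.bivectorPart Γ₁ = Λ at *
    generalize ComplexDGA.mixedPart Γ₁ = Δ at *
    generalize ComplexDGA.formPart Γ₁ = Ω at *
    generalize ComplexDGA.block₄ φ = φ₄ at *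
    generalize ComplexDGA.block₁ φ + ComplexDGA.block₂ φ = φ₁₂ at *
    generalize ComplexDGA.block₃ φ = φ₃ at *
    have hI : Complex.I * Complex.I = -1 := Complex.I_mul_I
    simp only [Complex.inv_I, inv_one, inv_neg] at h1 h2 h3
    refine ⟨?_, ?_, ?_⟩
    -- The weights `a, b, c` at `1, -1, i` solve `a - b + i c = 1`, `a + b + c = 0`, `a - b - i c =
    -- 0`.
    · convert ((h1.smul (1 / 4 + Complex.I / 4)).add (h2.smul (-1 / 4 + Complex.I / 4))).add
        (h3.smul (-Complex.I / 2)) using 1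
      all_goals
        match_scalars <;>
        first | ring1 | linear_combination (1 / 2) * hI | linear_combination (-1 / 2) * hI
    -- Exchanging `t` and `t⁻¹` replaces `i` by `-i`, so the weights are the conjugates of the
    -- previous ones.
    · convert ((h1.smul (1 / 4 - Complex.I / 4)).add (h2.smul (-1 / 4 - Complex.I / 4))).add
        (h3.smul (Complex.I / 2)) using 1
      all_goals
        match_scalars <;>
        first | ring1 | linear_combination (1 / 2) * hI | linear_combination (-1 / 2) * hI
    -- Averaging over `t = ±1` kills the two odd terms.
    · convert (h1.smul (1 / 2)).add (h2.smul (1 / 2)) using 1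
      · module
      · module
  · rintro ⟨h₁, h₂, h₃⟩
    convert (h₁.add h₂).add h₃ using 1
    · simp only [funext_iff, Pi.add_apply, ComplexDGA.mixedPart]
      intro x
      abel
    · funext x
      -- At `t = 1` the conjugation is trivial and the weight formula becomes the block
      -- decomposition of `φ`.
      have h := ComplexDGA.conjL_eq one_ne_zero (φ x)
      rw [ComplexDGA.conjL, inv_one, ComplexDGA.scaleL_one, ContinuousLinearMap.comp_id,
        ContinuousLinearMap.id_comp, one_smul, one_smul] at h
      rw [h]
      simp only [Pi.add_apply, ComplexDGA.block₁, ComplexDGA.block₂, ComplexDGA.block₃,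
        ComplexDGA.block₄]
      abel
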